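/- Let $p$ be a prime. Define $\mathrm{twr}(0)=1$, $\mathrm{twr}(i+1)=2^{\mathrm{twr}(i)}$. For a subspace $H\leqslant\mathbb{F}_p^n$ let $\mathcal{P}(H)$ be the partition of $\mathbb{F}_p^n$ into cosets of $H$ and let $\mathbb{E}$ denote averages. A function $f:\mathbb{F}_p^n\to\mathbb{C}$ is $\eta$-uniform on $H+c$ if, with $g=f-\mathbb{E}_{x\in H+c}f(x)$, $$\Big|\mathbb{E}_{x\in H+c}\,g(x)\,e^{2\pi i\, r^{T}x/p}\Big|\leq\eta\quad\text{for all } r\in\mathbb{F}_p^n.$$ The partition $\mathcal{P}(H)$ is $\eta$-regular for $f$ if $f$ is $\eta$-uniform on $H+c$ for all but at most an $\eta$-proportion of $c\in\mathbb{F}_p^n$. For $f:\mathbb{F}_p^n\to[0,1]$ the energy of $H$ with respect to $f$ is $\mathcal{E}(H)=\mathbb{E}_{x\in\mathbb{F}_p^n}\big(\mathbb{E}_{y\in H+x}f(y)\big)^2$. Theorem (Lower bound for strong regularity). Fix $0<\delta\leq\frac{1}{20p}$ and a non-increasing function $\varepsilon:\mathbb{N}\to(0,1)$ (where $0\in\mathbb{N}$)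 such that $\varepsilon(0)\leq\frac{\sqrt{\delta}}{80p^2}$. Define $F:\mathbb{N}\to\mathbb{N}$ by $F(0)=0$ and $$F(i+1)=\mathrm{twr}\left(\left\lfloor\frac{\sqrt{\delta}}{8p\,\varepsilon(F(i))}\right\rfloor\right).$$ Then for all sufficiently large $n$ (depending on $p,\delta,\varepsilon$) there exists a function $f:\mathbb{F}_p^n\to[0,1]$ for which the following holds. If $W_2\leqslant W_1\leqslant\mathbb{F}_p^n$ are subspaces satisfying (i) $\mathcal{P}(W_2)$ is $\varepsilon(C)$-regular for $f$, where $C=\mathrm{codim}\,W_1$; (ii) $\mathcal{E}(W_2)-\mathcal{E}(W_1)\leq\delta$; then $C\geq F\left(\left\lfloor\frac{\sqrt{\delta^{-1}}}{10p}\right\rfloor-1\right)$, where $F(-1)$ is read as $0$. -/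

import Mathlib

open scoped BigOperators

noncomputable section

/-- The vector space `𝔽_p^n`. -/
abbrev FpVec (p n : ℕ) : Type := Fin n → ZMod p

/-- The tower function: `twr 0 = 1`, `twr (i + 1) = 2 ^ twr i`. -/
def twr : ℕ → ℕ
  | 0 => 1
  | i + 1 => 2 ^ twr i

/-- The wowzer-type function `F(0) = 0`, `F(i+1) = twr ⌊√δ / (8 p ε(F(i)))⌋`. -/
def wowzerBound (p : ℕ) (δ : ℝ) (ε : ℕ → ℝ) : ℕ → ℕ
  | 0 => 0
  | i + 1 => twr ⌊√δ / (8 * p * ε (wowzerBound p δ ε i))⌋₊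

section
variable {p n : ℕ} [NeZero p]

/-- The codimension of a subspace of `𝔽_p^n`. -/
def codim (H : Submodule (ZMod p) (FpVec p n)) : ℕ :=
  Module.finrank (ZMod p) (FpVec p n ⧸ H)

open Classical in
/-- The coset `H + c`, as a finite set; the cosets of `H` are the parts of `𝒫(H)`. -/
def coset (H : Submodule (ZMod p) (FpVec p n)) (c : FpVec p n) : Finset (FpVec p n) :=
  {x | x - c ∈ H}

/-- The Fourier transform of `F` on `H + c` at `r`, that is `𝔼_{x ∈ H + c} F(x) e_p(rᵀ x)`;
here `ZMod.stdAddChar a = exp (2 π i a / p)`. -/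
def cosetFourier (H : Submodule (ZMod p) (FpVec p n)) (c : FpVec p n)
    (F : FpVec p n → ℂ) (r : FpVec p n) : ℂ :=
  Finset.expect (coset H c) fun x => F x * ZMod.stdAddChar (r ⬝ᵥ x)

/-- `f` is `η`-uniform on `H + c`: every Fourier coefficient on `H + c` of
`f - 𝔼_{x ∈ H + c} f(x)` has absolute value at most `η`. -/
def IsUniformOn (H : Submodule (ZMod p) (FpVec p n)) (c : FpVec p n)
    (η : ℝ) (f : FpVec p n → ℂ) : Prop :=
  ∀ r : FpVec p n, ‖cosetFourier H c (fun x => f x - Finset.expect (coset H c) f) r‖ ≤ η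

open Classical in
/-- `𝒫(H)` is `η`-regular for `f`: for all but at most an `η`-proportion of `c ∈ 𝔽_p^n`,
`f` is `η`-uniform on `H + c`. -/
def IsRegularPartition (H : Submodule (ZMod p) (FpVec p n)) (η : ℝ) (f : FpVec p n → ℂ) : Prop :=
  ((Finset.univ.filter fun c : FpVec p n => ¬ IsUniformOn H c η f).card : ℝ) ≤
    η * Fintype.card (FpVec p n)

/-- `𝔼(f | 𝒫(H))(x)`, the density of `f` on the coset of `H` that contains `x`. -/
def cosetDensity (H : Submodule (ZMod p) (FpVec p n)) (f : FpVec p n → ℝ) (x : FpVec p n) : ℝ :=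
  Finset.expect (coset H x) f

/-- The energy `ℰ(H) = ‖𝔼(f | 𝒫(H))‖²` in the `L²` norm of the uniform probability measure. -/
def energy (H : Submodule (ZMod p) (FpVec p n)) (f : FpVec p n → ℝ) : ℝ :=
  Finset.expect Finset.univ fun x : FpVec p n => |cosetDensity H f x| ^ 2

end

end

/-! Cut the coordinates into consecutive blocks, each exponentially long in the number of
coordinates before it, and take `f` to be a sum of layers `w k * 1[u k x ⬝ᵥ x = 0]`. Here `u k x` is
a linear form on block `k` selected by the coordinates of `x` before that block. A random code makes
the selection so varied that every nonzero direction in the block lies outside the kernels for more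
than 1/16 of all `x`.

Two facts follow. If `W₂` vanishes before block `k` and is regular with parameter well below `w k /
p`, then it vanishes on block `k` as well (`le_next_of_isRegularPartition`): otherwise the layer
leaves a large Fourier coefficient at the frequency `u k c` on many cosets. If `W₂` vanishes through
block `k` while `W₁` contains a direction starting in that block, then `W₂` sees the layer and `W₁`
averages it out along that direction, so the energy rises by more than `w k ^ 2 / (16 * p ^ 2)`
(`lt_energy_sub_energy`).

The weights iterate this. Level `i` spreads mass `b` thinly over the layers below `T i`, with `T i`
about `√δ / (p ε(F i))`, and puts another `b` on layer `T i`. Once `codim W₁ ≥ F i`, regularity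
drives `W₂` through all these layers. The block of layer `T i` has length at least `F (i + 1)`, so a
smaller codimension would leave `W₁` a direction in it, and the heavy weight would push the energy
gap above `δ`. -/

/-! ### Equidistribution along a direction, and random codes -/

/-- Translating by multiples of `h` fixes `G` and `u`, while `u x ⬝ᵥ x` runs once through all
residues wherever `G x ≠ 0`. Applied to a character it gives cancellation, applied to the indicator
of zero it gives density `1 / p`. -/
theorem card_mul_sum_comp_dotProduct {p : ℕ} [Fact p.Prime] {ι R : Type*} [Fintype ι]
    [DecidableEq ι] [CommSemiring R] (G : (ι → ZMod p) → R) (u : (ι → ZMod p) → ι → ZMod p)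
    (h : ι → ZMod p) (ψ : ZMod p → R) (hG : ∀ x (t : ZMod p), G (x + t • h) = G x)
    (hu : ∀ x (t : ZMod p), u (x + t • h) = u x) (hne : ∀ x, G x ≠ 0 → u x ⬝ᵥ h ≠ 0) :
    (p : R) * ∑ x, G x * ψ (u x ⬝ᵥ x) = (∑ a, ψ a) * ∑ x, G x := by
  have key : ∀ t : ZMod p, ∑ x, G x * ψ (u x ⬝ᵥ x) =
      ∑ x, G x * ψ (u x ⬝ᵥ x + t * (u x ⬝ᵥ h)) := fun t => by
    rw [← Equiv.sum_comp (Equiv.addRight (t • h))]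
    refine Finset.sum_congr rfl fun x _ => ?_
    simp only [Equiv.coe_addRight, hG, hu, dotProduct_add, dotProduct_smul, smul_eq_mul]
  calc (p : R) * ∑ x, G x * ψ (u x ⬝ᵥ x)
      = ∑ _t : ZMod p, ∑ x, G x * ψ (u x ⬝ᵥ x) := by simp [ZMod.card]
    _ = ∑ t : ZMod p, ∑ x, G x * ψ (u x ⬝ᵥ x + t * (u x ⬝ᵥ h)) :=
        Finset.sum_congr rfl fun t _ => key t
    _ = ∑ x, G x * ∑ t : ZMod p, ψ (u x ⬝ᵥ x + t * (u x ⬝ᵥ h)) := by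
        rw [Finset.sum_comm]
        exact Finset.sum_congr rfl fun x _ => (Finset.mul_sum _ _ _).symm
    _ = ∑ x, G x * ∑ a, ψ a := by
        refine Finset.sum_congr rfl fun x _ => ?_
        by_cases hx : G x = 0
        · simp [hx]
        · congr 1
          exact ((Equiv.mulRight₀ _ (hne x hx)).trans (Equiv.addLeft (u x ⬝ᵥ x))).sum_comp ψ
    _ = (∑ a, ψ a) * ∑ x, G x := by rw [← Finset.sum_mul, mul_comm]

/-- Random linear codes: a map `c` all of whose affine coordinate forms are nonzero on more than
one sixteenth of the points. -/
theorem exists_code (p : ℕ) [Fact p.Prime] (A I : Type*) [Fintype A] [Nonempty A] [Fintype I]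
    [DecidableEq A] [DecidableEq I]
    (hI : Fintype.card I = 0 ∨ 4 * (Fintype.card I + 1) ≤ Fintype.card A) :
    ∃ c : A → I → ZMod p, ∀ (y₀ : ZMod p) (y : I → ZMod p), (y₀ ≠ 0 ∨ y ≠ 0) →
      Fintype.card A < 16 * (Finset.univ.filter fun a => y₀ + y ⬝ᵥ c a ≠ 0).card := by
  have hp : 2 ≤ p := (Fact.out : p.Prime).two_le
  by_contra! hcon
  set N := Fintype.card A with hN
  have hNpos : 0 < N := Fintype.card_pos
  set d := Fintype.card I with hd
  have hbad : ∀ c : A → I → ZMod p, ∃ (y₀ : ZMod p) (y : I → ZMod p), y ≠ 0 ∧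
      16 * (Finset.univ.filter fun a => y₀ + y ⬝ᵥ c a ≠ 0).card ≤ N := by
    intro c
    obtain ⟨y₀, y, hy, hc⟩ := hcon c
    refine ⟨y₀, y, ?_, hc⟩
    rintro rfl
    have : y₀ ≠ 0 := by simpa using hy
    simp [this] at hc
    omega
  have hd1 : 4 * (d + 1) ≤ N := by
    rcases hI with h | h
    · obtain ⟨_, y, hy, _⟩ := hbad 0
      have := Fintype.card_eq_zero_iff.1 h
      exact (hy (Subsingleton.elim _ _)).elim
    · exact h
  -- Exponential moment with factor `p ^ 2` per zero: a word with at most `N / 16` nonzero entries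
  -- has product at least `B`, while for `y ≠ 0` one factor has mean at most `p + 1`. The sum over
  -- all `(y₀, y)` is the union bound.
  let g : ZMod p → ℕ := fun z => if z = 0 then p ^ 2 else 1
  have hg : ∑ z, g z ≤ p * (p + 1) := by
    calc ∑ z, g z ≤ ∑ z : ZMod p, ((if z = 0 then p ^ 2 else 0) + 1) :=
          Finset.sum_le_sum fun z _ => by simp only [g]; split_ifs <;> omega
      _ = p * (p + 1) := by
          rw [Finset.sum_add_distrib]; simp [ZMod.card]; ring
  have hone : ∀ (y₀ : ZMod p) (y : I → ZMod p), y ≠ 0 →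
      ∑ v : I → ZMod p, g (y₀ + y ⬝ᵥ v) ≤ p ^ d * (p + 1) := by
    intro y₀ y hy
    obtain ⟨i, hi⟩ := Function.ne_iff.1 hy
    have h1 := card_mul_sum_comp_dotProduct (p := p) (R := ℕ) (fun _ => 1) (fun _ => y)
      (Pi.single i 1) (fun a => g (y₀ + a)) (fun _ _ => rfl) (fun _ _ => rfl)
      (fun _ _ => by simpa using hi)
    have h2 : ∑ a, g (y₀ + a) = ∑ a, g a := Equiv.sum_comp (Equiv.addLeft y₀) g
    simp only [one_mul, h2, Finset.sum_const, Finset.card_univ, Fintype.card_fun, ZMod.card,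
      smul_eq_mul, mul_one, Nat.cast_id] at h1
    have h3 : p * ∑ v : I → ZMod p, g (y₀ + y ⬝ᵥ v) ≤ p * (p ^ d * (p + 1)) := by
      rw [h1]; calc _ ≤ p * (p + 1) * p ^ d := Nat.mul_le_mul_right _ hg
        _ = _ := by ring
    exact Nat.le_of_mul_le_mul_left h3 (by omega)
  set B := p ^ (2 * (N - N / 16)) with hB
  have hlow : ∀ c : A → I → ZMod p,
      B ≤ ∑ q : ZMod p × (I → ZMod p), if q.2 = 0 then 0 else ∏ a, g (q.1 + q.2 ⬝ᵥ c a) := by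
    intro c
    obtain ⟨y₀, y, hy, hc⟩ := hbad c
    refine le_trans ?_ (Finset.single_le_sum
      (f := fun q : ZMod p × (I → ZMod p) => if q.2 = 0 then 0 else ∏ a, g (q.1 + q.2 ⬝ᵥ c a))
      (fun _ _ => Nat.zero_le _) (Finset.mem_univ (y₀, y)))
    simp only [hy, if_false, g]
    rw [Finset.prod_ite]
    simp only [Finset.prod_const, one_pow, mul_one]
    rw [← pow_mul, hB]
    apply Nat.pow_le_pow_right (by omega)
    have := Finset.card_filter_add_card_filter_not (s := (Finset.univ : Finset A))
      (fun a => y₀ + y ⬝ᵥ c a = 0)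
    rw [Finset.card_univ] at this
    have h16 : (Finset.univ.filter fun a => ¬ (y₀ + y ⬝ᵥ c a = 0)).card ≤ N / 16 := by
      simp only [ne_eq] at hc
      omega
    omega
  have hsum : p ^ (d * N) * B ≤ p ^ (d + 1) * (p ^ d * (p + 1)) ^ N := by
    calc p ^ (d * N) * B = ∑ _c : A → I → ZMod p, B := by
          simp [ZMod.card, ← hN, ← hd, pow_mul]
      _ ≤ ∑ c : A → I → ZMod p, ∑ q : ZMod p × (I → ZMod p),
            if q.2 = 0 then 0 else ∏ a, g (q.1 + q.2 ⬝ᵥ c a) :=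
          Finset.sum_le_sum fun c _ => hlow c
      _ = ∑ q : ZMod p × (I → ZMod p), ∑ c : A → I → ZMod p,
            if q.2 = 0 then 0 else ∏ a, g (q.1 + q.2 ⬝ᵥ c a) := Finset.sum_comm
      _ ≤ ∑ _q : ZMod p × (I → ZMod p), (p ^ d * (p + 1)) ^ N := by
          refine Finset.sum_le_sum fun q _ => ?_
          by_cases hq : q.2 = 0
          · simp [hq]
          · simp only [hq, if_false]
            rw [← Fintype.piFinset_univ, ← Finset.prod_univ_sum (fun _ => Finset.univ)
              (fun _ v => g (q.1 + q.2 ⬝ᵥ v)), Finset.prod_const, Finset.card_univ]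
            exact Nat.pow_le_pow_left (hone _ _ hq) _
      _ = p ^ (d + 1) * (p ^ d * (p + 1)) ^ N := by
          simp [ZMod.card, ← hd, pow_succ']
  have hB2 : B ≤ p ^ (d + 1) * (p + 1) ^ N := by
    have : p ^ (d * N) * B ≤ p ^ (d * N) * (p ^ (d + 1) * (p + 1) ^ N) := by
      refine hsum.trans_eq ?_
      rw [mul_pow, ← pow_mul]; ring
    exact Nat.le_of_mul_le_mul_left this (by positivity)
  -- Holds since `(3 / 2) ^ 8 < 2 ^ 5`. With `4 * (d + 1) ≤ N` the eighth power of the union bound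
  -- stays below `p ^ (15 * N)`.
  have h8 : (p + 1) ^ 8 < p ^ 13 := by
    have h3 : 2 * (p + 1) ≤ 3 * p := by omega
    have h4 : (2 * (p + 1)) ^ 8 ≤ (3 * p) ^ 8 := Nat.pow_le_pow_left h3 _
    have h5 : 2 ^ 5 ≤ p ^ 5 := Nat.pow_le_pow_left hp 5
    have h6 : 0 < p ^ 8 := by positivity
    have h7 : p ^ 13 = p ^ 8 * p ^ 5 := by ring
    rw [mul_pow, mul_pow] at h4
    nlinarith
  have hlt : B ^ 8 < p ^ (15 * N) := by
    calc B ^ 8 ≤ (p ^ (d + 1) * (p + 1) ^ N) ^ 8 := Nat.pow_le_pow_left hB2 8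
      _ = p ^ (8 * (d + 1)) * ((p + 1) ^ 8) ^ N := by
          rw [mul_pow, ← pow_mul, ← pow_mul, ← pow_mul]; ring_nf
      _ < p ^ (8 * (d + 1)) * (p ^ 13) ^ N :=
          Nat.mul_lt_mul_of_pos_left (Nat.pow_lt_pow_left h8 (by omega)) (by positivity)
      _ = p ^ (8 * (d + 1) + 13 * N) := by rw [← pow_mul, ← pow_add]
      _ ≤ p ^ (15 * N) := Nat.pow_le_pow_right (by omega) (by omega)
  have hge : p ^ (15 * N) ≤ B ^ 8 := by
    rw [hB, ← pow_mul]
    exact Nat.pow_le_pow_right (by omega) (by omega)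
  omega

/-! ### Layers of linear forms -/

/-- `u x` is, for each `x`, a linear form in the coordinates of the block `[D, D')`, chosen
according to the coordinates of `x` below `D`. A fixed direction lies outside all kernels, and
every direction inside the block lies outside of more than one sixteenth of them. -/
structure IsLayer {p n : ℕ} [NeZero p] (D D' : ℕ) (u : FpVec p n → FpVec p n) : Prop where
  congr : ∀ x y, (∀ i : Fin n, i.val < D → x i = y i) → u x = u y
  supp_ge : ∀ x (i : Fin n), D' ≤ i.val → u x i = 0
  pivot : ∃ e : FpVec p n, (∀ i : Fin n, i.val < D → e i = 0) ∧ ∀ x, u x ⬝ᵥ e ≠ 0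
  spread : ∀ h : FpVec p n, (∀ i : Fin n, i.val < D → h i = 0) →
    (∃ i : Fin n, i.val < D' ∧ h i ≠ 0) →
      p ^ n < 16 * (Finset.univ.filter fun x => u x ⬝ᵥ h ≠ 0).card

/-- The length of the block that follows the first `D` coordinates. -/
def blockLength (p D : ℕ) : ℕ := max 1 (p ^ D / 4)

/-- The form has coefficient 1 at coordinate `D` and the code word of the first `D` coordinates of
`x` on the rest of the block. The fixed coefficient supplies the pivot direction, and it is why the
code must handle affine forms, with constant term `h i₀`. -/
theorem exists_isLayer (p n D : ℕ) [Fact p.Prime] (hn : D + blockLength p D ≤ n) :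
    ∃ u : FpVec p n → FpVec p n, IsLayer D (D + blockLength p D) u := by
  classical
  set d := blockLength p D with hd
  have hd1 : 1 ≤ d := le_max_left _ _
  let J := {i : Fin n // i.val < D}
  let I := {i : Fin n // D < i.val ∧ i.val < D + d}
  have hJ : Fintype.card J = D := by
    rw [Fintype.card_subtype]
    have := Fin.card_filter_val_lt (n := n) (m := D)
    rw [this]; omega
  have hA : Fintype.card (J → ZMod p) = p ^ D := by simp [ZMod.card, hJ]
  have hI : Fintype.card I = d - 1 := by
    rw [Fintype.card_subtype, ← Finset.card_map Fin.valEmbedding]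
    have : (Finset.univ.filter fun i : Fin n => D < i.val ∧ i.val < D + d).map Fin.valEmbedding
        = Finset.Ioo D (D + d) := by
      ext j
      simp only [Finset.mem_map, Finset.mem_filter, Finset.mem_univ, true_and,
        Fin.valEmbedding_apply, Finset.mem_Ioo]
      constructor
      · rintro ⟨i, hi, rfl⟩; exact hi
      · intro hj; exact ⟨⟨j, by omega⟩, hj, rfl⟩
    rw [this, Nat.card_Ioo]; omega
  have hcond : Fintype.card I = 0 ∨ 4 * (Fintype.card I + 1) ≤ Fintype.card (J → ZMod p) := by
    rw [hI, hA]
    rcases le_total (p ^ D / 4) 1 with h | h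
    · left; rw [hd, blockLength, max_eq_left h]
    · right; rw [hd, blockLength, max_eq_right h]; omega
  obtain ⟨c, hc⟩ := exists_code p (J → ZMod p) I hcond
  let i₀ : Fin n := ⟨D, by omega⟩
  let u : FpVec p n → FpVec p n := fun x i =>
    if i = i₀ then 1 else if hi : D < i.val ∧ i.val < D + d then
      c (fun j => x j.1) ⟨i, hi⟩ else 0
  have hdot : ∀ x h, u x ⬝ᵥ h = h i₀ + (fun i : I => h i.1) ⬝ᵥ c (fun j => x j.1) := by
    intro x h
    have : ∀ i, u x i * h i = (if i = i₀ then h i else 0) +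
        (if hi : D < i.val ∧ i.val < D + d then h i * c (fun j => x j.1) ⟨i, hi⟩ else 0) := by
      intro i
      by_cases hi : i = i₀
      · subst hi; simp [u, i₀]
      · by_cases hi' : D < i.val ∧ i.val < D + d
        · simp [u, hi, hi', mul_comm]
        · simp [u, hi, hi']
    rw [dotProduct, Finset.sum_congr rfl fun i _ => this i, Finset.sum_add_distrib]
    congr 1
    · simp
    · rw [dotProduct]
      rw [← Finset.sum_filter_of_ne (p := fun i : Fin n => D < i.val ∧ i.val < D + d)
        (fun i _ hi => by by_contra hc; simp [hc] at hi), Finset.sum_subtype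
          (p := fun i : Fin n => D < i.val ∧ i.val < D + d) _ (by simp)]
      exact Finset.sum_congr rfl fun i _ => dif_pos i.2
  refine ⟨u, fun x y hxy => ?_, fun x i hi => ?_,
    ⟨Pi.single i₀ 1, fun i hi => ?_, fun x => ?_⟩, fun h h0 ⟨i, hi, hne⟩ => ?_⟩
  · have : (fun j : J => x j.1) = fun j : J => y j.1 := funext fun j => hxy j.1 j.2
    funext i
    simp only [u, this]
  · have h1 : i ≠ i₀ := fun h => by simp [h, i₀] at hi; omega
    have h2 : ¬ (D < i.val ∧ i.val < D + d) := by omega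
    simp [u, h1, h2]
  · have h1 : i ≠ i₀ := fun h => by simp [h, i₀] at hi
    simp [h1]
  · simp [u]
  · have hy : h i₀ ≠ 0 ∨ (fun i : I => h i.1) ≠ 0 := by
      by_contra! hcon
      apply hne
      rcases lt_trichotomy i.val D with hlt | heq | hgt
      · exact h0 i hlt
      · rw [← hcon.1]; congr 1; exact Fin.ext heq
      · exact congrFun hcon.2 ⟨i, hgt, hi⟩
    have hN := hc _ _ hy
    have hcard : (Finset.univ.filter fun x => u x ⬝ᵥ h ≠ 0).card =
        (Finset.univ.filter fun a : J → ZMod p =>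
          h i₀ + (fun i : I => h i.1) ⬝ᵥ c a ≠ 0).card * p ^ (n - D) := by
      let e := Equiv.piEquivPiSubtypeProd (fun i : Fin n => i.val < D) (fun _ => ZMod p)
      have h1 : (Finset.univ.filter fun x => u x ⬝ᵥ h ≠ 0).map e.toEmbedding =
          (Finset.univ.filter fun a : J → ZMod p =>
          h i₀ + (fun i : I => h i.1) ⬝ᵥ c a ≠ 0) ×ˢ Finset.univ := by
        ext q
        simp only [Finset.mem_map_equiv, Finset.mem_filter, Finset.mem_univ, true_and,
          Finset.mem_product, and_true, hdot]
        have : (fun j : J => e.symm q j.1) = q.1 := by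
          funext j
          exact congrFun (congrArg Prod.fst (e.apply_symm_apply q)) j
        rw [this]
      rw [← Finset.card_map e.toEmbedding, h1, Finset.card_product, Finset.card_univ]
      congr 1
      rw [Fintype.card_fun, ZMod.card, Fintype.card_subtype_compl, Fintype.card_fin]
      congr 2
    rw [hcard, ← mul_assoc]
    rw [hA] at hN
    calc p ^ n = p ^ D * p ^ (n - D) := by rw [← pow_add]; congr 1; omega
      _ < _ := Nat.mul_lt_mul_of_pos_right hN (by
          have := (Fact.out : p.Prime).pos; positivity)

/-! ### Coset averages and energy -/

theorem mem_coset {p n : ℕ} [NeZero p] {H : Submodule (ZMod p) (FpVec p n)} {c x : FpVec p n} :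
    x ∈ coset H c ↔ x - c ∈ H := by
  classical
  simp [coset]

theorem coset_eq_of_sub_mem {p n : ℕ} [NeZero p] {H : Submodule (ZMod p) (FpVec p n)}
    {c c' : FpVec p n} (h : c' - c ∈ H) : coset H c' = coset H c := by
  ext x
  rw [mem_coset, mem_coset]
  have e : x - c = x - c' + (c' - c) := by abel
  rw [e, H.add_mem_iff_left h]

theorem expect_coset {p n : ℕ} [NeZero p] {M : Type*} [AddCommMonoid M] [Module ℚ≥0 M]
    (H : Submodule (ZMod p) (FpVec p n)) (c : FpVec p n) (F : FpVec p n → M) [Fintype H] :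
    Finset.expect (coset H c) F = Finset.expect Finset.univ fun y : H => F (c + y) := by
  symm
  refine Finset.expect_bij (fun y _ => c + y.1) (fun y _ => by simp [mem_coset])
    (fun _ _ => rfl) (fun y _ z _ hyz => Subtype.ext (add_left_cancel hyz)) fun x hx => ?_
  exact ⟨⟨x - c, mem_coset.1 hx⟩, Finset.mem_univ _, by simp⟩

/-- Averaging over the cosets of `H` is self-adjoint. -/
theorem sum_mul_expect_coset {p n : ℕ} [NeZero p] {R : Type*} [Field R] [CharZero R]
    (H : Submodule (ZMod p) (FpVec p n)) (G F : FpVec p n → R)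
    (hG : ∀ x, ∀ y ∈ H, G (x + y) = G x) :
    ∑ c, G c * Finset.expect (coset H c) F = ∑ x, G x * F x := by
  classical
  have : Fintype H := Fintype.ofFinite H
  calc ∑ c, G c * Finset.expect (coset H c) F
      = ∑ c, Finset.expect Finset.univ fun y : H => G (c + y) * F (c + y) := by
        refine Finset.sum_congr rfl fun c _ => ?_
        rw [expect_coset, Finset.mul_expect]
        exact Finset.expect_congr rfl fun y _ => by rw [hG c y y.2]
    _ = Finset.expect Finset.univ fun y : H => ∑ c, G (c + y) * F (c + y) :=
        (Finset.expect_sum_comm _ _ _).symm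
    _ = Finset.expect Finset.univ fun _y : H => ∑ c, G c * F c :=
        Finset.expect_congr rfl fun y _ =>
          Equiv.sum_comp (Equiv.addRight (y : FpVec p n)) fun c => G c * F c
    _ = ∑ x, G x * F x := Finset.expect_const Finset.univ_nonempty _

theorem expect_coset_add {p n : ℕ} [NeZero p] {M : Type*} [AddCommMonoid M] [Module ℚ≥0 M]
    (H : Submodule (ZMod p) (FpVec p n)) (F : FpVec p n → M) (x y : FpVec p n) (hy : y ∈ H) :
    Finset.expect (coset H (x + y)) F = Finset.expect (coset H x) F := by
  rw [coset_eq_of_sub_mem (c := x) (c' := x + y) (by simpa using hy)]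

/-- The energy increment is the squared distance of the two density functions. -/
theorem energy_sub_energy {p n : ℕ} [NeZero p] {W₁ W₂ : Submodule (ZMod p) (FpVec p n)}
    (h : W₂ ≤ W₁) (f : FpVec p n → ℝ) :
    (energy W₂ f - energy W₁ f) * (p ^ n : ℕ) =
      ∑ x, (cosetDensity W₂ f x - cosetDensity W₁ f x) ^ 2 := by
  have hcard : (Fintype.card (FpVec p n) : ℝ) = (p ^ n : ℕ) := by simp [ZMod.card]
  have henergy : ∀ W : Submodule (ZMod p) (FpVec p n),
      energy W f * (p ^ n : ℕ) = ∑ x, cosetDensity W f x ^ 2 := fun W => by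
    simp only [energy, sq_abs]
    rw [← hcard, mul_comm, Fintype.card_mul_expect]
  -- Used for both `W₁` and `W₂`: each cross term equals the inner product of the coarse density
  -- with `f`, which is Pythagoras.
  have hinv : ∀ W : Submodule (ZMod p) (FpVec p n), W ≤ W₁ →
      ∑ x, cosetDensity W₁ f x * cosetDensity W f x = ∑ x, cosetDensity W₁ f x * f x :=
    fun W hW => sum_mul_expect_coset W (cosetDensity W₁ f) f fun x y hy =>
      expect_coset_add W₁ f x y (hW hy)
  have h1 := hinv W₁ le_rfl
  have h2 := hinv W₂ h
  rw [sub_mul, henergy, henergy]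
  have : ∀ x, (cosetDensity W₂ f x - cosetDensity W₁ f x) ^ 2 = cosetDensity W₂ f x ^ 2 -
      2 * (cosetDensity W₁ f x * cosetDensity W₂ f x) +
      cosetDensity W₁ f x * cosetDensity W₁ f x := fun x => by ring
  rw [Finset.sum_congr rfl fun x _ => this x, Finset.sum_add_distrib, Finset.sum_sub_distrib,
    ← Finset.mul_sum, h2, ← h1]
  simp only [← sq]
  ring

theorem norm_cosetFourier_le_one {p n : ℕ} [NeZero p] (H : Submodule (ZMod p) (FpVec p n))
    (c r : FpVec p n) (f : FpVec p n → ℝ) (hf : ∀ x, f x ∈ Set.Icc (0 : ℝ) 1) :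
    ‖cosetFourier H c
      (fun x => (f x : ℂ) - Finset.expect (coset H c) fun y => (f y : ℂ)) r‖ ≤ 1 := by
  have hne : (coset H c).Nonempty := ⟨c, by simp [mem_coset]⟩
  have hμ : (Finset.expect (coset H c) fun y => (f y : ℂ)) =
      ((Finset.expect (coset H c) f : ℝ) : ℂ) := by push_cast; rfl
  have hμ0 : 0 ≤ Finset.expect (coset H c) f := Finset.expect_nonneg fun x _ => (hf x).1
  have hμ1 : Finset.expect (coset H c) f ≤ 1 := Finset.expect_le hne fun x _ => (hf x).2
  refine (RCLike.norm_expect_le (K := ℂ)).trans (Finset.expect_le hne fun x _ => ?_)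
  rw [norm_mul, AddChar.norm_apply, mul_one, hμ]
  beta_reduce
  rw [← Complex.ofReal_sub, Complex.norm_real, Real.norm_eq_abs, abs_le]
  constructor <;> linarith [(hf x).1, (hf x).2]

theorem sum_stdAddChar (p : ℕ) [Fact p.Prime] :
    ∑ a : ZMod p, (ZMod.stdAddChar a : ℂ) = 0 := by
  apply AddChar.sum_eq_zero_of_ne_one
  have := ZMod.isPrimitive_stdAddChar p (one_ne_zero (α := ZMod p))
  intro h
  apply this
  ext a
  simp [h]

/-! ### Fourier coefficients, regularity and energy of a sum of layers -/

namespace IsLayer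

variable {p n : ℕ} [NeZero p] {D D' : ℕ} {u : FpVec p n → FpVec p n}

theorem apply_add_smul (hu : IsLayer D D' u) {h : FpVec p n}
    (hh : ∀ i : Fin n, i.val < D → h i = 0) (x : FpVec p n) (t : ZMod p) :
    u (x + t • h) = u x :=
  hu.congr _ _ fun i hi => by simp [hh i hi]

theorem dotProduct_eq_zero (hu : IsLayer D D' u) {h : FpVec p n}
    (hh : ∀ i : Fin n, i.val < D' → h i = 0) (x : FpVec p n) : u x ⬝ᵥ h = 0 := by
  refine Finset.sum_eq_zero fun i _ => ?_
  rcases lt_or_ge i.val D' with hi | hi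
  · rw [hh i hi, mul_zero]
  · rw [hu.supp_ge x i hi, zero_mul]

theorem dotProduct_add_smul (hu : IsLayer D D' u) {h : FpVec p n}
    (hh : ∀ i : Fin n, i.val < D' → h i = 0) (x y : FpVec p n) (t : ZMod p) :
    u x ⬝ᵥ (y + t • h) = u x ⬝ᵥ y := by
  rw [dotProduct_add, dotProduct_smul, hu.dotProduct_eq_zero hh, smul_zero, add_zero]

end IsLayer

/-- The weighted sum of the indicators of `u k x ⬝ᵥ x = 0`. -/
noncomputable def layerSum {p n : ℕ} (K : ℕ) (w : ℕ → ℝ) (u : ℕ → FpVec p n → FpVec p n)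
    (x : FpVec p n) : ℝ :=
  ∑ k ∈ Finset.range K, w k * if u k x ⬝ᵥ x = 0 then 1 else 0

theorem layerSum_mem_Icc {p n K : ℕ} {w : ℕ → ℝ} (hw : ∀ k, 0 ≤ w k)
    (hw1 : ∑ k ∈ Finset.range K, w k ≤ 1) (u : ℕ → FpVec p n → FpVec p n) (x : FpVec p n) :
    layerSum K w u x ∈ Set.Icc (0 : ℝ) 1 := by
  refine ⟨Finset.sum_nonneg fun k _ => mul_nonneg (hw k) (by split_ifs <;> norm_num),
    (Finset.sum_le_sum fun k _ => ?_).trans hw1⟩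
  have := hw k
  split_ifs <;> simp [this]

section

variable {p n K : ℕ} [Fact p.Prime] {D : ℕ → ℕ} {w : ℕ → ℝ} {u : ℕ → FpVec p n → FpVec p n}

/-- The character of layer `k` is orthogonal to the other layers, even on the set where `h` moves `u
k`. For `j < k` a shift along `h` leaves layer `j` fixed and cancels the character; for `j = k` the
character is 1 on the indicator. -/
theorem sum_good_mul_layer (hD : Monotone D) (hu : ∀ k < K, IsLayer (D k) (D (k + 1)) (u k))
    {j k : ℕ} (hj : j < K) (hk : k < K) {h : FpVec p n}
    (hh : ∀ i : Fin n, i.val < D k → h i = 0) :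
    (p : ℂ) * ∑ x, (if u k x ⬝ᵥ h ≠ 0 then 1 else 0) * (if u j x ⬝ᵥ x = 0 then 1 else 0) *
        (ZMod.stdAddChar (u k x ⬝ᵥ x) : ℂ) =
      if j = k then ((Finset.univ.filter fun x => u k x ⬝ᵥ h ≠ 0).card : ℂ) else 0 := by
  have huk := fun x t => (hu k hk).apply_add_smul hh x t
  have hp0 : (p : ℂ) ≠ 0 := Nat.cast_ne_zero.2 (Fact.out : p.Prime).ne_zero
  rcases lt_trichotomy j k with hjk | rfl | hjk
  · have hh' : ∀ i : Fin n, i.val < D (j + 1) → h i = 0 := fun i hi => hh i (hi.trans_le (hD hjk))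
    have huj := fun x t => (hu j hj).apply_add_smul
      (fun i hi => hh' i (hi.trans_le (hD j.le_succ))) x t
    rw [card_mul_sum_comp_dotProduct (fun x => (if u k x ⬝ᵥ h ≠ 0 then (1 : ℂ) else 0) *
      if u j x ⬝ᵥ x = 0 then 1 else 0) (u k) h (fun a => (ZMod.stdAddChar a : ℂ)), sum_stdAddChar,
      zero_mul, if_neg hjk.ne]
    · intro x t
      simp only [huk, huj, (hu j hj).dotProduct_add_smul hh']
    · exact huk
    · intro x hx hc
      simp [hc] at hx
  · have := card_mul_sum_comp_dotProduct (fun x => if u j x ⬝ᵥ h ≠ 0 then (1 : ℂ) else 0) (u j) h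
      (fun a => if a = 0 then (1 : ℂ) else 0) (fun x t => by simp only [huk]) huk
      (fun x hx hc => by simp [hc] at hx)
    rw [if_pos rfl]
    simp only [Finset.sum_ite_eq', Finset.mem_univ, if_true, one_mul] at this
    rw [Finset.sum_boole] at this
    rw [← this]
    congr 1
    refine Finset.sum_congr rfl fun x _ => ?_
    by_cases hx : u j x ⬝ᵥ x = 0 <;> simp [hx]
  -- For `j > k`, shifts along the pivot of layer `j` do not affect layer `k`, so the indicator may
  -- be replaced by its density; the character sum that remains cancels along `h`.
  · obtain ⟨e, he, hne⟩ := (hu j hj).pivot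
    have he' : ∀ i : Fin n, i.val < D (k + 1) → e i = 0 := fun i hi => he i (hi.trans_le (hD hjk))
    have huke := fun x t => (hu k hk).apply_add_smul
      (fun i hi => he' i (hi.trans_le (hD k.le_succ))) x t
    have h1 := card_mul_sum_comp_dotProduct (fun x => if u k x ⬝ᵥ h ≠ 0 then (1 : ℂ) else 0) (u k) h
      (fun a => (ZMod.stdAddChar a : ℂ)) (fun x t => by simp only [huk]) huk
      (fun x hx hc => by simp [hc] at hx)
    have h2 := card_mul_sum_comp_dotProduct (fun x => (if u k x ⬝ᵥ h ≠ 0 then (1 : ℂ) else 0) *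
      (ZMod.stdAddChar (u k x ⬝ᵥ x) : ℂ)) (u j) e
      (fun a => if a = 0 then (1 : ℂ) else 0)
      (fun x t => by simp only [huke, (hu k hk).dotProduct_add_smul he'])
      (fun x t => (hu j hj).apply_add_smul he x t) (fun x _ => hne x)
    rw [sum_stdAddChar, zero_mul] at h1
    rw [(mul_eq_zero.1 h1).resolve_left hp0, mul_zero] at h2
    rw [if_neg hjk.ne']
    refine Eq.trans (congrArg _ ?_) h2
    exact Finset.sum_congr rfl fun x _ => mul_right_comm _ _ _

theorem sum_good_mul_layerSum (hD : Monotone D) (hu : ∀ k < K, IsLayer (D k) (D (k + 1)) (u k))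
    {k : ℕ} (hk : k < K) {h : FpVec p n} (hh : ∀ i : Fin n, i.val < D k → h i = 0) :
    ∑ x, (if u k x ⬝ᵥ h ≠ 0 then 1 else 0) * ((layerSum K w u x : ℂ) *
        (ZMod.stdAddChar (u k x ⬝ᵥ x) : ℂ)) =
      w k * (Finset.univ.filter fun x => u k x ⬝ᵥ h ≠ 0).card / p := by
  have hp0 : (p : ℂ) ≠ 0 := Nat.cast_ne_zero.2 (Fact.out : p.Prime).ne_zero
  rw [eq_div_iff hp0, mul_comm]
  calc (p : ℂ) * ∑ x, (if u k x ⬝ᵥ h ≠ 0 then 1 else 0) * ((layerSum K w u x : ℂ) *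
        (ZMod.stdAddChar (u k x ⬝ᵥ x) : ℂ))
      = ∑ j ∈ Finset.range K, (w j : ℂ) * ((p : ℂ) * ∑ x, (if u k x ⬝ᵥ h ≠ 0 then 1 else 0) *
          (if u j x ⬝ᵥ x = 0 then 1 else 0) * (ZMod.stdAddChar (u k x ⬝ᵥ x) : ℂ)) := by
        simp only [Finset.mul_sum]
        rw [Finset.sum_comm]
        refine Finset.sum_congr rfl fun x _ => ?_
        simp only [layerSum, Complex.ofReal_sum, Complex.ofReal_mul, Finset.sum_mul,
          Finset.mul_sum]
        refine Finset.sum_congr rfl fun j _ => ?_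
        have : (((if u j x ⬝ᵥ x = 0 then 1 else 0 : ℝ)) : ℂ) =
          if u j x ⬝ᵥ x = 0 then 1 else 0 := by split_ifs <;> simp
        rw [this]
        ring
    _ = ∑ j ∈ Finset.range K, (w j : ℂ) *
          if j = k then ((Finset.univ.filter fun x => u k x ⬝ᵥ h ≠ 0).card : ℂ) else 0 :=
        Finset.sum_congr rfl fun j hj => by
          rw [sum_good_mul_layer hD hu (Finset.mem_range.1 hj) hk hh]
    _ = _ := by simp [hk]

/-- Regularity on the cosets of `H` pushes `H` below the next layer. -/
theorem le_next_of_isRegularPartition (hD : Monotone D)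
    (hu : ∀ k < K, IsLayer (D k) (D (k + 1)) (u k)) (hw : ∀ k, 0 ≤ w k)
    (hw1 : ∑ k ∈ Finset.range K, w k ≤ 1) {k : ℕ} (hk : k < K) {η : ℝ} (hη : 0 ≤ η)
    (hwk : 32 * p * η < w k) {H : Submodule (ZMod p) (FpVec p n)}
    (hH : ∀ y ∈ H, ∀ i : Fin n, i.val < D k → y i = 0)
    (hreg : IsRegularPartition H η fun x => (layerSum K w u x : ℂ)) :
    ∀ y ∈ H, ∀ i : Fin n, i.val < D (k + 1) → y i = 0 := by
  classical
  intro h hhH i hi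
  by_contra hne
  have hh := hH h hhH
  have hspread := (hu k hk).spread h hh ⟨i, hi, hne⟩
  set f := layerSum K w u with hf
  have hf01 : ∀ x, f x ∈ Set.Icc (0 : ℝ) 1 := layerSum_mem_Icc hw hw1 u
  set S := Finset.univ.filter fun x => u k x ⬝ᵥ h ≠ 0 with hS
  have hp0 : (0 : ℝ) < p := Nat.cast_pos.2 (Fact.out : p.Prime).pos
  -- The frequency `u k c` depends only on the coset, because `H` vanishes before block `k`.
  let coef : FpVec p n → ℂ := fun c => cosetFourier H c
    (fun x => (f x : ℂ) - Finset.expect (coset H c) fun y => (f y : ℂ)) (u k c)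
  have huH : ∀ x, ∀ y ∈ H, u k (x + y) = u k x := fun x y hy =>
    (hu k hk).congr _ _ fun i hi => by simp [hH y hy i hi]
  have huc : ∀ c, ∀ x ∈ coset H c, u k x = u k c := fun c x hx => by
    have := huH c (x - c) (mem_coset.1 hx)
    rwa [add_sub_cancel] at this
  -- The coset means contribute nothing: they are invariant along `h ∈ H`, which moves the character
  -- on `S`.
  have hsum : ∑ c ∈ S, coef c = w k * S.card / p := by
    rw [← sum_good_mul_layerSum hD hu hk hh]
    have hμ : ∀ x y, y ∈ H → (Finset.expect (coset H (x + y)) fun z => (f z : ℂ)) =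
        Finset.expect (coset H x) fun z => (f z : ℂ) := fun x y hy =>
      expect_coset_add H _ x y hy
    have hcoef : ∀ c, coef c = Finset.expect (coset H c) fun x =>
        ((f x : ℂ) - Finset.expect (coset H x) fun y => (f y : ℂ)) *
          ZMod.stdAddChar (u k x ⬝ᵥ x) := fun c =>
      Finset.expect_congr rfl fun x hx => by
        rw [huc c x hx, coset_eq_of_sub_mem (mem_coset.1 hx)]
    rw [hS, Finset.sum_filter]
    have e1 : ∀ c, (if u k c ⬝ᵥ h ≠ 0 then coef c else 0) =
        (if u k c ⬝ᵥ h ≠ 0 then 1 else 0) * coef c := fun c => by split_ifs <;> simp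
    rw [Finset.sum_congr rfl fun c _ => e1 c]
    simp only [hcoef]
    rw [sum_mul_expect_coset H _ _ fun x y hy => by rw [huH x y hy]]
    simp only [sub_mul, mul_sub, Finset.sum_sub_distrib]
    rw [sub_eq_self]
    have huk := fun x t => (hu k hk).apply_add_smul hh x t
    have h1 := card_mul_sum_comp_dotProduct (fun x => (if u k x ⬝ᵥ h ≠ 0 then (1 : ℂ) else 0) *
      Finset.expect (coset H x) fun y => (f y : ℂ)) (u k) h
      (fun a => (ZMod.stdAddChar a : ℂ))
      (fun x t => by simp only [huk, hμ x (t • h) (H.smul_mem t hhH)]) huk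
      (fun x hx hc => by simp [hc] at hx)
    rw [sum_stdAddChar, zero_mul] at h1
    simpa only [mul_assoc] using
      (mul_eq_zero.1 h1).resolve_left (Nat.cast_ne_zero.2 (Fact.out : p.Prime).ne_zero)
  have hcard : (Fintype.card (FpVec p n) : ℝ) = (p : ℝ) ^ n := by simp [ZMod.card]
  have hSle : (S.card : ℝ) ≤ (p : ℝ) ^ n := by
    rw [← hcard]; exact_mod_cast Finset.card_le_univ S
  -- Irregular cosets have proportion at most `η` and coefficients at most 1; elsewhere the
  -- coefficients are at most `η`. Together with `p ^ n < 16 * S.card` this contradicts `32 * p * η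
  -- < w k`.
  have hupper : w k * S.card / p ≤ η * (p : ℝ) ^ n + η * (p : ℝ) ^ n := by
    calc w k * S.card / p = ‖∑ c ∈ S, coef c‖ := by
          have : (w k * S.card / p : ℂ) = ((w k * S.card / p : ℝ) : ℂ) := by push_cast; rfl
          rw [hsum, this, Complex.norm_real, Real.norm_of_nonneg]
          have := hw k
          positivity
      _ ≤ ∑ c ∈ S, ‖coef c‖ := norm_sum_le _ _
      _ ≤ ∑ c ∈ S, ((if ¬ IsUniformOn H c η (fun x => (f x : ℂ)) then 1 else 0) + η) := by
          refine Finset.sum_le_sum fun c _ => ?_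
          split_ifs with hc
          · linarith [hc (u k c)]
          · linarith [norm_cosetFourier_le_one H c (u k c) f hf01]
      _ ≤ ∑ c, (if ¬ IsUniformOn H c η (fun x => (f x : ℂ)) then (1 : ℝ) else 0)
            + η * (p : ℝ) ^ n := by
          rw [Finset.sum_add_distrib]
          refine add_le_add (Finset.sum_le_univ_sum_of_nonneg fun c => by split_ifs <;> norm_num) ?_
          rw [Finset.sum_const, nsmul_eq_mul, mul_comm]
          exact mul_le_mul_of_nonneg_left hSle hη
      _ ≤ _ := by
          rw [Finset.sum_boole, ← hcard]
          refine add_le_add_left ?_ _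
          rw [IsRegularPartition] at hreg
          convert hreg using 1
  rw [div_le_iff₀ hp0] at hupper
  have hs : (p : ℝ) ^ n < 16 * S.card := by exact_mod_cast hspread
  have hP : (0 : ℝ) < (p : ℝ) ^ n := by positivity
  have hw0 : 0 < w k := lt_of_le_of_lt (by positivity) hwk
  nlinarith [mul_lt_mul_of_pos_left hs hw0, mul_lt_mul_of_pos_right hwk hP]

/-- A direction of `W₁` inside layer `k` yields an energy increment when `W₂` lies below it. -/
theorem lt_energy_sub_energy (hD : Monotone D)
    (hu : ∀ k < K, IsLayer (D k) (D (k + 1)) (u k)) {k : ℕ} (hk : k < K) (hwk : 0 < w k)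
    {W₁ W₂ : Submodule (ZMod p) (FpVec p n)} (hW : W₂ ≤ W₁)
    (hW₂ : ∀ y ∈ W₂, ∀ i : Fin n, i.val < D (k + 1) → y i = 0) {h : FpVec p n} (hhW : h ∈ W₁)
    (hh : ∀ i : Fin n, i.val < D k → h i = 0) (hne : ∃ i : Fin n, i.val < D (k + 1) ∧ h i ≠ 0) :
    w k ^ 2 / (16 * p ^ 2) < energy W₂ (layerSum K w u) - energy W₁ (layerSum K w u) := by
  have hspread := (hu k hk).spread h hh hne
  set f := layerSum K w u with hf
  set S := Finset.univ.filter fun x => u k x ⬝ᵥ h ≠ 0 with hS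
  have hp0 : (0 : ℝ) < p := Nat.cast_pos.2 (Fact.out : p.Prime).pos
  have hP : (0 : ℝ) < (p : ℝ) ^ n := by positivity
  -- The test function is `W₂`-invariant, so it correlates with the density on `W₂` exactly as with
  -- `f`; against the density on `W₁` it cancels along `h`.
  let φ : FpVec p n → ℂ := fun x =>
    (if u k x ⬝ᵥ h ≠ 0 then 1 else 0) * (ZMod.stdAddChar (u k x ⬝ᵥ x) : ℂ)
  let d₁ := cosetDensity W₁ f
  let d₂ := cosetDensity W₂ f
  have hcast : ∀ W : Submodule (ZMod p) (FpVec p n), ∀ x, ((cosetDensity W f x : ℝ) : ℂ) =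
      Finset.expect (coset W x) fun y => (f y : ℂ) := fun W x => by
    simp [cosetDensity]
  have h2 : ∑ x, φ x * (d₂ x : ℂ) = w k * S.card / p := by
    rw [← sum_good_mul_layerSum hD hu hk hh]
    simp only [d₂, hcast]
    rw [sum_mul_expect_coset W₂ φ]
    · refine Finset.sum_congr rfl fun x _ => ?_
      simp only [φ]; ring
    · intro x y hy
      have e1 := (hu k hk).apply_add_smul (fun i hi => hW₂ y hy i (hi.trans_le (hD k.le_succ))) x 1
      have e2 := (hu k hk).dotProduct_add_smul (hW₂ y hy) x x 1
      rw [one_smul] at e1 e2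
      simp only [φ, e1, e2]
  have h1 : ∑ x, φ x * (d₁ x : ℂ) = 0 := by
    have huk := fun x t => (hu k hk).apply_add_smul hh x t
    have h1 := card_mul_sum_comp_dotProduct (fun x => (if u k x ⬝ᵥ h ≠ 0 then (1 : ℂ) else 0) *
      (d₁ x : ℂ)) (u k) h (fun a => (ZMod.stdAddChar a : ℂ))
      (fun x t => by
        simp only [huk, d₁, cosetDensity, expect_coset_add W₁ f x (t • h) (W₁.smul_mem t hhW)]) huk
      (fun x hx hc => by simp [hc] at hx)
    rw [sum_stdAddChar, zero_mul] at h1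
    rw [← (mul_eq_zero.1 h1).resolve_left (Nat.cast_ne_zero.2 (Fact.out : p.Prime).ne_zero)]
    exact Finset.sum_congr rfl fun x _ => mul_right_comm _ _ _
  have hdiff : ∑ x, φ x * ((d₂ x - d₁ x : ℝ) : ℂ) = ((w k * S.card / p : ℝ) : ℂ) := by
    push_cast
    simp only [mul_sub, Finset.sum_sub_distrib, h1, h2, sub_zero]
  have hφ : ∀ x, ‖φ x‖ = if u k x ⬝ᵥ h ≠ 0 then 1 else 0 := fun x => by
    simp only [φ, norm_mul, AddChar.norm_apply, mul_one]
    split_ifs <;> simp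
  have hle : w k * S.card / p ≤
      ∑ x, (if u k x ⬝ᵥ h ≠ 0 then (1 : ℝ) else 0) * |d₂ x - d₁ x| := by
    have h3 : ‖∑ x, φ x * ((d₂ x - d₁ x : ℝ) : ℂ)‖ = w k * S.card / p := by
      rw [hdiff, Complex.norm_real, Real.norm_of_nonneg (by positivity)]
    rw [← h3]
    refine (norm_sum_le _ _).trans_eq (Finset.sum_congr rfl fun x _ => ?_)
    rw [norm_mul, hφ, Complex.norm_real, Real.norm_eq_abs]
  -- Cauchy–Schwarz on the support `S` of the test function.
  have hCS : (w k * S.card / p) ^ 2 ≤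
      S.card * ((energy W₂ f - energy W₁ f) * (p ^ n : ℕ)) := by
    rw [energy_sub_energy hW]
    refine (pow_le_pow_left₀ (by positivity) hle 2).trans
      ((Finset.sum_mul_sq_le_sq_mul_sq _ _ _).trans_eq ?_)
    simp only [sq_abs, ite_pow, one_pow, ne_eq, OfNat.ofNat_ne_zero, not_false_eq_true, zero_pow]
    rw [Finset.sum_boole]
  have hs : (p : ℝ) ^ n < 16 * S.card := by exact_mod_cast hspread
  have hSpos : (0 : ℝ) < S.card := by linarith
  push_cast at hCS
  set Δ := energy W₂ f - energy W₁ f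
  have h4 : w k ^ 2 * S.card ≤ Δ * (p : ℝ) ^ n * p ^ 2 := by
    rw [div_pow, div_le_iff₀ (by positivity)] at hCS
    have : S.card * (w k ^ 2 * S.card) ≤ S.card * (Δ * (p : ℝ) ^ n * p ^ 2) := by
      nlinarith
    exact le_of_mul_le_mul_left this hSpos
  rw [div_lt_iff₀ (by positivity)]
  have h5 : w k ^ 2 * (p : ℝ) ^ n < Δ * (16 * p ^ 2) * (p : ℝ) ^ n := by
    nlinarith [mul_lt_mul_of_pos_left hs (by positivity : 0 < w k ^ 2)]
  exact lt_of_mul_lt_mul_right h5 hP.le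

end

/-! ### Dimension count and tower growth of the blocks -/

theorem exists_mem_of_codim_lt {p n D D' : ℕ} [Fact p.Prime] (hn : D' ≤ n)
    (W : Submodule (ZMod p) (FpVec p n)) (hW : codim W < D' - D) :
    ∃ h ∈ W, (∀ i : Fin n, i.val < D → h i = 0) ∧ ∃ i : Fin n, i.val < D' ∧ h i ≠ 0 := by
  let I := {i : Fin n // D ≤ i.val ∧ i.val < D'}
  have hI : Fintype.card I = D' - D := by
    rw [Fintype.card_subtype, ← Finset.card_map Fin.valEmbedding]
    have : (Finset.univ.filter fun i : Fin n => D ≤ i.val ∧ i.val < D').map Fin.valEmbedding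
        = Finset.Ico D D' := by
      ext j
      simp only [Finset.mem_map, Finset.mem_filter, Finset.mem_univ, true_and,
        Fin.valEmbedding_apply, Finset.mem_Ico]
      constructor
      · rintro ⟨i, hi, rfl⟩; exact hi
      · intro hj; exact ⟨⟨j, by omega⟩, hj, rfl⟩
    rw [this, Nat.card_Ico]
  let E : (I → ZMod p) →ₗ[ZMod p] FpVec p n :=
    Function.ExtendByZero.linearMap (ZMod p) (Subtype.val : I → Fin n)
  have hEin : ∀ v (i : I), E v i.1 = v i := fun v i =>
    Subtype.val_injective.extend_apply _ _ _
  have hEout : ∀ v (i : Fin n), ¬ (D ≤ i.val ∧ i.val < D') → E v i = 0 := fun v i hi =>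
    Function.extend_apply' _ _ _ fun ⟨j, hj⟩ => hi (hj ▸ j.2)
  have hker := LinearMap.ker_ne_bot_of_finrank_lt (f := W.mkQ ∘ₗ E)
    (by rw [Module.finrank_fintype_fun_eq_card, hI]; exact hW)
  obtain ⟨v, hv, hv0⟩ := Submodule.exists_mem_ne_zero_of_ne_bot hker
  obtain ⟨i, hi⟩ := Function.ne_iff.1 hv0
  refine ⟨E v, ?_, fun j hj => hEout v j (by omega), i.1, i.2.2, ?_⟩
  · simpa using hv
  · rw [hEin]; exact hi

/-- The number of coordinates that precede the `k`-th block. -/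
def blockStart (p : ℕ) : ℕ → ℕ
  | 0 => 0
  | k + 1 => blockStart p k + blockLength p (blockStart p k)

theorem blockStart_monotone (p : ℕ) : Monotone (blockStart p) :=
  monotone_nat_of_le_succ fun _ => Nat.le_add_right _ _

theorem two_pow_le_blockLength {p t D : ℕ} (hp : 2 ≤ p) (hD : t + 2 ≤ D) :
    2 ^ t ≤ blockLength p D := by
  refine le_trans ?_ (le_max_right _ _)
  rw [Nat.le_div_iff_mul_le (by norm_num)]
  calc 2 ^ t * 4 = 2 ^ (t + 2) := by ring
    _ ≤ 2 ^ D := Nat.pow_le_pow_right (by norm_num) hD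
    _ ≤ p ^ D := Nat.pow_le_pow_left hp D

/-- The surplus 2 pays for the factor 1/4 in the block length. It is available from index 3 on,
after three blocks of length at least 1. -/
theorem twr_add_two_le_blockStart {p : ℕ} (hp : 2 ≤ p) (k : ℕ) :
    twr k + 2 ≤ blockStart p (k + 3) := by
  have hone : ∀ D, 1 ≤ blockLength p D := fun D => le_max_left _ _
  induction k with
  | zero =>
    simp only [blockStart, twr]
    have h0 := hone 0
    have h1 := hone (0 + blockLength p 0)
    have h2 := hone (0 + blockLength p 0 + blockLength p (0 + blockLength p 0))
    omega
  | succ k ih =>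
    have := two_pow_le_blockLength hp ih
    rw [show k + 1 + 3 = (k + 3) + 1 from rfl, blockStart, twr]
    omega

theorem twr_le_blockLength {p : ℕ} (hp : 2 ≤ p) (k : ℕ) :
    twr k ≤ blockLength p (blockStart p (k + 2)) := by
  cases k with
  | zero => exact le_max_left _ _
  | succ k => exact two_pow_le_blockLength hp (twr_add_two_le_blockStart hp k)

/-! ### Weights of the layers -/

/-- Weights giving level `i` a share `b / T i` of each layer below `T i` and a share `b` of
layer `T i`. -/
noncomputable def levelWeight (L : ℕ) (T : ℕ → ℕ) (b : ℝ) (k : ℕ) : ℝ :=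
  ∑ i ∈ Finset.range L, ((if k < T i then b / T i else 0) + if k = T i then b else 0)

theorem levelWeight_term_nonneg {T : ℕ → ℕ} {b : ℝ} (hb : 0 ≤ b) (k i : ℕ) :
    0 ≤ (if k < T i then b / T i else 0) + if k = T i then b else 0 := by
  split_ifs <;> positivity

theorem levelWeight_nonneg {L : ℕ} {T : ℕ → ℕ} {b : ℝ} (hb : 0 ≤ b) (k : ℕ) :
    0 ≤ levelWeight L T b k :=
  Finset.sum_nonneg fun i _ => levelWeight_term_nonneg hb k i

theorem div_le_levelWeight {L : ℕ} {T : ℕ → ℕ} {b : ℝ} (hb : 0 ≤ b) {i k : ℕ} (hi : i < L)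
    (hk : k < T i) : b / T i ≤ levelWeight L T b k := by
  refine le_trans ?_ (Finset.single_le_sum (fun i _ => levelWeight_term_nonneg hb k i)
    (Finset.mem_range.2 hi))
  simp [hk, hk.ne]

theorem le_levelWeight {L : ℕ} {T : ℕ → ℕ} {b : ℝ} (hb : 0 ≤ b) {i : ℕ} (hi : i < L) :
    b ≤ levelWeight L T b (T i) := by
  refine le_trans ?_ (Finset.single_le_sum (fun j _ => levelWeight_term_nonneg hb (T i) j)
    (Finset.mem_range.2 hi))
  simp

theorem sum_levelWeight_le {L : ℕ} {T : ℕ → ℕ} {b : ℝ} (hb : 0 ≤ b) (hT : ∀ i, 0 < T i) (K : ℕ) :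
    ∑ k ∈ Finset.range K, levelWeight L T b k ≤ L * (2 * b) := by
  unfold levelWeight
  rw [Finset.sum_comm]
  calc _ ≤ ∑ _i ∈ Finset.range L, 2 * b := by
        refine Finset.sum_le_sum fun i _ => ?_
        rw [Finset.sum_add_distrib, two_mul]
        refine add_le_add ?_ ?_
        · rw [← Finset.sum_filter, Finset.sum_const, nsmul_eq_mul]
          have hc : ((Finset.range K).filter fun k => k < T i).card ≤ T i := by
            refine (Finset.card_le_card (t := Finset.range (T i)) fun k hk => ?_).trans_eq
              (Finset.card_range _)
            exact Finset.mem_range.2 (Finset.mem_filter.1 hk).2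
          have hTi : (0 : ℝ) < T i := Nat.cast_pos.2 (hT i)
          calc _ ≤ (T i : ℝ) * (b / T i) :=
                mul_le_mul_of_nonneg_right (Nat.cast_le.2 hc) (by positivity)
            _ = b := mul_div_cancel₀ _ hTi.ne'
        · rw [Finset.sum_ite_eq']
          split_ifs <;> simp [hb]
    _ = _ := by simp

/-! ### The lower bound -/

theorem mainTheorem2 (p : ℕ) [Fact p.Prime] (δ : ℝ) (hδ : 0 < δ) (hδ' : δ ≤ 1 / (20 * p))
    (ε : ℕ → ℝ) (hε : ∀ d, ε d ∈ Set.Ioo (0 : ℝ) 1) (hanti : Antitone ε)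
    (hε0 : ε 0 ≤ √δ / (80 * p ^ 2)) :
    ∃ N : ℕ, ∀ n : ℕ, N ≤ n →
      ∃ f : FpVec p n → ℝ, (∀ x, f x ∈ Set.Icc (0 : ℝ) 1) ∧
        ∀ W₁ W₂ : Submodule (ZMod p) (FpVec p n), W₂ ≤ W₁ →
          IsRegularPartition W₂ (ε (codim W₁)) (fun x => (f x : ℂ)) →
          energy W₂ f - energy W₁ f ≤ δ →
          wowzerBound p δ ε (⌊√(δ⁻¹) / (10 * p)⌋₊ - 1) ≤ codim W₁ := by
  have hp2 : 2 ≤ p := (Fact.out : p.Prime).two_le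
  have hp2' : (2 : ℝ) ≤ p := by exact_mod_cast hp2
  have hs : 0 < √δ := Real.sqrt_pos.2 hδ
  set L := ⌊√(δ⁻¹) / (10 * p)⌋₊ - 1 with hL
  set F := wowzerBound p δ ε with hF
  let ht : ℕ → ℕ := fun i => ⌊√δ / (8 * p * ε (F i))⌋₊
  -- The shift by 2 is the one in `twr_le_blockLength`.
  let T : ℕ → ℕ := fun i => ht i + 2
  -- Large enough that `b ^ 2 / (16 * p ^ 2) = 25 * δ / 16` exceeds `δ`, small enough that `L`
  -- levels of mass `2 * b` fit into total mass 1.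
  set b : ℝ := 5 * p * √δ with hb
  have hb0 : 0 < b := by positivity
  let w := levelWeight L T b
  let K := ∑ i ∈ Finset.range L, (T i + 1)
  have hTK : ∀ i < L, T i < K := fun i hi =>
    Finset.single_le_sum (f := fun i => T i + 1) (fun _ _ => Nat.zero_le _) (Finset.mem_range.2 hi)
  have hw : ∀ k, 0 ≤ w k := levelWeight_nonneg hb0.le
  have hw1 : ∑ k ∈ Finset.range K, w k ≤ 1 := by
    refine (sum_levelWeight_le hb0.le (fun i => Nat.succ_pos _) K).trans ?_
    have h1 : (L : ℝ) ≤ √(δ⁻¹) / (10 * p) :=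
      (Nat.cast_le.2 (Nat.sub_le _ _)).trans (Nat.floor_le (by positivity))
    calc (L : ℝ) * (2 * b) ≤ √(δ⁻¹) / (10 * p) * (2 * b) :=
          mul_le_mul_of_nonneg_right h1 (by positivity)
      _ = 1 := by rw [hb, Real.sqrt_inv]; field_simp; norm_num
  have hwη : ∀ i < L, ∀ k ≤ T i, 32 * p * ε (F i) < w k := by
    intro i hi k hk
    have hη := (hε (F i)).1
    have hη0 : ε (F i) ≤ √δ / (80 * p ^ 2) := (hanti (Nat.zero_le _)).trans hε0
    -- This lets the added 2 in `T i` be absorbed by doubling the quotient.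
    have hge : 2 ≤ √δ / (8 * p * ε (F i)) := by
      rw [le_div_iff₀ (by positivity)] at hη0 ⊢
      nlinarith
    have hT2 : (T i : ℝ) ≤ 2 * (√δ / (8 * p * ε (F i))) := by
      have := Nat.floor_le (show 0 ≤ √δ / (8 * p * ε (F i)) by positivity)
      simp only [T, ht, Nat.cast_add, Nat.cast_ofNat]
      linarith
    have hTpos : (1 : ℝ) ≤ T i := by exact_mod_cast Nat.succ_pos _
    have hbT : 32 * p * ε (F i) < b / T i := by
      rw [lt_div_iff₀ (by linarith)]
      calc 32 * p * ε (F i) * T i ≤ 32 * p * ε (F i) * (2 * (√δ / (8 * p * ε (F i)))) :=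
            mul_le_mul_of_nonneg_left hT2 (by positivity)
        _ = 8 * √δ := by field_simp; norm_num
        _ < b := by rw [hb]; nlinarith
    refine hbT.trans_le ?_
    rcases hk.lt_or_eq with hk | rfl
    · exact div_le_levelWeight hb0.le hi hk
    · exact (div_le_self hb0.le hTpos).trans (le_levelWeight hb0.le hi)
  refine ⟨blockStart p K, fun n hn => ?_⟩
  have hex : ∀ k, ∃ u : FpVec p n → FpVec p n,
      k < K → IsLayer (blockStart p k) (blockStart p (k + 1)) u := fun k => by
    by_cases hk : k < K
    · obtain ⟨u, hu⟩ := exists_isLayer p n (blockStart p k)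
        (((blockStart_monotone p) hk).trans hn)
      exact ⟨u, fun _ => hu⟩
    · exact ⟨id, fun h => absurd h hk⟩
  choose u hu using hex
  have hD := blockStart_monotone p
  refine ⟨layerSum K w u, layerSum_mem_Icc hw hw1 u, fun W₁ W₂ hW hreg hen => ?_⟩
  suffices H : ∀ i ≤ L, F i ≤ codim W₁ from H L le_rfl
  intro i
  induction i with
  | zero => exact fun _ => Nat.zero_le _
  | succ i ih =>
    intro hi
    have hC := hanti (ih (by omega))
    -- By the induction hypothesis and monotonicity, `ε (codim W₁) ≤ ε (F i)`, which is small
    -- against every weight up to layer `T i`.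
    have hpush : ∀ k ≤ T i + 1, ∀ y ∈ W₂, ∀ j : Fin n, j.val < blockStart p k → y j = 0 := by
      intro k
      induction k with
      | zero => exact fun _ y _ j hj => absurd hj (Nat.not_lt_zero _)
      | succ k ihk =>
        intro hk
        have hkT : k ≤ T i := by omega
        refine le_next_of_isRegularPartition hD hu hw hw1 (hkT.trans_lt (hTK i hi))
          (hε (codim W₁)).1.le ?_ (ihk (by omega)) hreg
        exact (mul_le_mul_of_nonneg_left hC (by positivity)).trans_lt (hwη i hi k hkT)
    by_contra! hlt
    -- The block of layer `T i` has length at least `twr (ht i)`, which is `F (i + 1)`.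
    have hdim : codim W₁ < blockStart p (T i + 1) - blockStart p (T i) := by
      rw [blockStart, Nat.add_sub_cancel_left]
      exact hlt.trans_le (twr_le_blockLength hp2 (ht i))
    obtain ⟨h, hhW, hh, hne⟩ := exists_mem_of_codim_lt ((hD (hTK i hi)).trans hn) W₁ hdim
    have hbw : b ≤ w (T i) := le_levelWeight hb0.le hi
    have hgap := lt_energy_sub_energy hD hu (hTK i hi) (hb0.trans_le hbw) hW (hpush _ le_rfl)
      hhW hh hne
    have hδlt : δ < w (T i) ^ 2 / (16 * p ^ 2) := by
      rw [lt_div_iff₀ (by positivity)]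
      have h1 : b ^ 2 ≤ w (T i) ^ 2 := pow_le_pow_left₀ hb0.le hbw 2
      have h2 : b ^ 2 = 25 * (δ * p ^ 2) := by
        rw [hb, mul_pow, mul_pow, Real.sq_sqrt hδ.le]; ring
      have h3 : 0 < δ * (p : ℝ) ^ 2 := by positivity
      nlinarith
    linarith
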